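/- Let $U$ be a countable set, let $k\ge 1$, and let $\mathcal C=(L_1,L_2,\dots)$ be a countable collection of non-empty subsets (languages) of $U$; repetitions are allowed. A $k$-list identifier is a function $A:U^*\to\mathbb N^k$. For a language $L$ of $\mathcal C$ and a list $\mu\in\mathbb N^k$, say that $\mu$ identifies $L$ if $L_i=L$ for some entry $i$ of $\mu$. The collection $\mathcal C$ is $k$-list identifiable in the limit if there is a $k$-list identifier $A$ such that for every $z$ and every enumeration $x_1,x_2,\dots$ of $L_z$ (a sequence in $L_z$, possibly with repetitions, in which every element of $L_z$ appears), the list $A(x_1,\dots,x_t)$ identifies $L_z$ for all sufficiently large $t$. A probability distribution $\mathcal D$ on $U$ is valid for $L$ if $\mathcal D(x)>0\iff x\in L$. For an identifier $A$, an index $z$ and a distribution $\mathcal D$ valid for $L_z$, put $$p_t(A,z,\mathcal D)=\Pr_{x_1,\dots,x_t\sim\mathcal D^t}\big[A(x_1,\dots,x_t)\text{ does not identify }L_z\big].$$ A rate function is a function $R:[0,\infty)\to[0,1]$ with $\lim_{s\to\infty}R(s)=0$. The collection $\mathcal C$ can be $k$-list identified at rate $R$ if there is a $k$-list identifier $A$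 such that for every $z$ and every $\mathcal D$ valid for $L_z$ there are constants $c_1,c_2>0$ with $p_t(A,z,\mathcal D)\le c_1R(c_2t)$ for all $t\ge 1$. It cannot be $k$-list identified at a rate faster than $R$ if for every $k$-list identifier $A$ there are $z$, a distribution $\mathcal D$ valid for $L_z$ and constants $c_1,c_2>0$ with $p_t(A,z,\mathcal D)\ge c_1R(c_2t)$ for infinitely many $t$. The rate $R$ is optimal for $\mathcal C$ if both hold. Then: 1. If $\mathcal C$ is $k$-list identifiable in the limit, then $\mathcal C$ can be $k$-list identified at rate $R(t)=e^{-t}$. 2. If $\mathcal C$ is non-trivial, i.e. some $k+1$ pairwise distinct languages of $\mathcal C$ have a common element, then $\mathcal C$ cannot be $k$-list identified at a rate faster than $e^{-t}$; more precisely, for every $k$-list identifier $A$ there are $z$ and a distribution $\mathcal D$ valid for $L_z$ with $p_t(A,z,\mathcal D)\ge e^{-2t}$ for infinitely many $t$. In particular, if $\mathcal C$ is non-trivial and $k$-list identifiable in the limit, then $e^{-t}$ is its optimal rate. 3. If $\mathcal C$ is not $k$-list identifiable in the limit, then for every $k$-list identifier $A$ there are $z$ and a distribution $\mathcal D$ valid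 for $L_z$ with $$\limsup_{t\to\infty}p_t(A,z,\mathcal D)\ge\frac1{k+1}.$$ In particular this $\limsup$ is positive, and $\mathcal C$ cannot be $k$-list identified at any rate function $R$. -/

import Mathlib

open MeasureTheory Filter Topology

namespace ListIdentification

/-- A `k`-list identifier: it maps every finite sequence of strings to a list of `k` indices. -/
abbrev ListIdentifier (U : Type*) (k : ℕ) : Type _ := List U → (Fin k → ℕ)

/-- The list `μ` contains an index of the language `K` in the collection `L`
(any index at which a copy of `K` occurs is accepted). -/
def Identifies {U : Type*} {k : ℕ} (L : ℕ → Set U) (μ : Fin k → ℕ) (K : Set U) : Prop :=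
  ∃ j : Fin k, L (μ j) = K

/-- `x` is an enumeration of `K`: every `x i` is in `K`, and every element of `K` appears. -/
def IsEnumeration {U : Type*} (K : Set U) (x : ℕ → U) : Prop :=
  (∀ i, x i ∈ K) ∧ ∀ y ∈ K, ∃ i, x i = y

/-- The identifier `A` identifies the collection `L` in the limit. The list
`List.ofFn (fun i : Fin t => x i)` consists of the first `t` strings of `x`. -/
def IdentifiesInLimit {U : Type*} {k : ℕ} (L : ℕ → Set U) (A : ListIdentifier U k) : Prop :=
  ∀ z : ℕ, ∀ x : ℕ → U, IsEnumeration (L z) x →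
    ∃ t₀ : ℕ, ∀ t : ℕ, t₀ ≤ t → Identifies L (A (List.ofFn (fun i : Fin t => x i))) (L z)

/-- The collection `L` is `k`-list identifiable in the limit. -/
def IdentifiableInLimit {U : Type*} (k : ℕ) (L : ℕ → Set U) : Prop :=
  ∃ A : ListIdentifier U k, IdentifiesInLimit L A

/-- The distribution `D` is valid for the language `K`: its support is exactly `K`. -/
def IsValid {U : Type*} (D : PMF U) (K : Set U) : Prop :=
  ∀ x, 0 < D x ↔ x ∈ K

/-- The probability, over `t` independent draws from `D`, that the list output by `A`
does not identify `K`. -/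
noncomputable def failProb {U : Type*} [MeasurableSpace U] {k : ℕ} (L : ℕ → Set U)
    (A : ListIdentifier U k) (K : Set U) (D : PMF U) (t : ℕ) : ℝ :=
  (Measure.pi (fun _ : Fin t => D.toMeasure)).real
    {x : Fin t → U | ¬ Identifies L (A (List.ofFn x)) K}

/-- A rate function: on nonnegative arguments it takes values in `[0,1]`, and it tends to `0`
at infinity. It is a function of a real argument because it is evaluated at `c₂ * t`; its values
at negative arguments are never used. -/
structure Rate where
  /-- the underlying function -/
  toFun : ℝ → ℝ
  mem_Icc : ∀ s : ℝ, 0 ≤ s → toFun s ∈ Set.Icc (0 : ℝ) 1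
  tendsto_zero : Tendsto toFun atTop (𝓝 0)

/-- The exponential rate `R(t) = e^{-t}`. -/
noncomputable def expRate : Rate where
  toFun := fun s => Real.exp (-s)
  mem_Icc := fun s hs => ⟨(Real.exp_pos _).le, Real.exp_le_one_iff.mpr (by linarith)⟩
  tendsto_zero := Real.tendsto_exp_neg_atTop_nhds_zero

/-- The collection `L` can be `k`-list identified at rate `R`. -/
def CanBeIdentifiedAtRate {U : Type*} [MeasurableSpace U] (k : ℕ) (L : ℕ → Set U)
    (R : Rate) : Prop :=
  ∃ A : ListIdentifier U k, ∀ z : ℕ, ∀ D : PMF U, IsValid D (L z) →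
    ∃ c₁ c₂ : ℝ, 0 < c₁ ∧ 0 < c₂ ∧
      ∀ t : ℕ, 1 ≤ t → failProb L A (L z) D t ≤ c₁ * R.toFun (c₂ * (t : ℝ))

/-- The collection `L` cannot be `k`-list identified at a rate faster than `R`. -/
def CannotBeIdentifiedFaster {U : Type*} [MeasurableSpace U] (k : ℕ) (L : ℕ → Set U)
    (R : Rate) : Prop :=
  ∀ A : ListIdentifier U k, ∃ z : ℕ, ∃ D : PMF U, IsValid D (L z) ∧
    ∃ c₁ c₂ : ℝ, 0 < c₁ ∧ 0 < c₂ ∧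
      ∃ᶠ t : ℕ in atTop, c₁ * R.toFun (c₂ * (t : ℝ)) ≤ failProb L A (L z) D t

/-- Rate `R` is the optimal rate for `k`-list identification of the collection `L`. -/
def IsOptimalRate {U : Type*} [MeasurableSpace U] (k : ℕ) (L : ℕ → Set U) (R : Rate) : Prop :=
  CanBeIdentifiedAtRate k L R ∧ CannotBeIdentifiedFaster k L R

/-- The collection `L` cannot be `k`-list identified at any rate. -/
def NoRate {U : Type*} [MeasurableSpace U] (k : ℕ) (L : ℕ → Set U) : Prop :=
  ∀ A : ListIdentifier U k, ∃ z : ℕ, ∃ D : PMF U, IsValid D (L z) ∧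
    0 < limsup (fun t : ℕ => failProb L A (L z) D t) atTop

/-- The collection `L` is non-trivial for `k`-list identification: some `k + 1` pairwise
distinct languages of the collection share a string. -/
def IsNontrivialFor {U : Type*} (k : ℕ) (L : ℕ → Set U) : Prop :=
  ∃ i : Fin (k + 1) → ℕ, Function.Injective (fun j => L (i j)) ∧ (⋂ j, L (i j)).Nonempty

end ListIdentification

open ListIdentification

namespace ListIdentification

open scoped ENNReal Classical

/-! Everything rests on one combinatorial condition: no language of the collection is `IsBad` of
order `k`.

The condition suffices for identification. Let `j + 1 ≤ k` be the first order at which a language is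
not bad. A finite telltale then separates it from all smaller languages that are bad of order `j`.
Slot `j` of the list guesses the first consistent language of rank `j` whose telltale has been seen
(`exists_identifier_of_not_isBad`). This guess is right once the sample contains a fixed finite set,
and a random sample misses such a set with exponentially small probability.

The condition is necessary as soon as the failure probabilities are eventually below `1 / (k + 1)`.
A language bad of order `j` carries distributions under which `j + 1` different languages are named
at the same time, each with average probability above `k / (k + 1)`
(`exists_lt_weightedSum_of_isBad`). For `j = k` more than `k` languages would be named on average by
a list of length `k`. Identification in the limit makes the failure probabilities tend to zero,
which gives the exponential rate; otherwise some limsup is at least `1 / (k + 1)`.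

The exponential lower bound is separate: a sample may repeat one common string, and `k` guesses then
miss one of `k + 1` languages. -/

/-- A language is bad of order `j + 1` when no finite subset of it separates it from all
strictly smaller languages of the collection that are bad of order `j`. -/
def IsBad {U : Type*} (L : ℕ → Set U) : ℕ → Set U → Prop
  | 0, _ => True
  | j + 1, K => ∀ T : Finset U, (T : Set U) ⊆ K →
      ∃ i, (T : Set U) ⊆ L i ∧ L i ⊂ K ∧ IsBad L j (L i)

/-- The integral of `G` over `t` independent draws from the weight `w`. -/
noncomputable def weightedSum {U : Type*} (w : U → ℝ≥0∞) (t : ℕ)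
    (G : (Fin t → U) → ℝ≥0∞) : ℝ≥0∞ :=
  ∑' x : Fin t → U, (∏ i, w (x i)) * G x

/-- A finitely supported weight on `K` of total mass less than one. -/
structure IsPartialWeight {U : Type*} (K : Set U) (w : U → ℝ≥0∞) : Prop where
  finite : (Function.support w).Finite
  subset : Function.support w ⊆ K
  lt_one : ∑' x, w x < 1

/-- The number of languages of `F` that are identified by the output of `A` on `x`. -/
noncomputable def identifiedCount {U : Type*} {k : ℕ} (L : ℕ → Set U) (A : ListIdentifier U k)
    (F : Finset (Set U)) {t : ℕ} (x : Fin t → U) : ℝ≥0∞ :=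
  ((F.filter (fun K => Identifies L (A (List.ofFn x)) K)).card : ℝ≥0∞)

/-! ### Integrals against weights and counts of named languages -/

variable {U : Type*} {k : ℕ}

lemma weightedSum_mono {w w' : U → ℝ≥0∞} (h : w ≤ w') (t : ℕ) (G : (Fin t → U) → ℝ≥0∞) :
    weightedSum w t G ≤ weightedSum w' t G :=
  ENNReal.tsum_le_tsum fun x => mul_le_mul_left (Finset.prod_le_prod' fun i _ => h (x i)) _

lemma identifiedCount_le (L : ℕ → Set U) (A : ListIdentifier U k) (F : Finset (Set U)) {t : ℕ}
    (x : Fin t → U) : identifiedCount L A F x ≤ k := by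
  unfold identifiedCount
  norm_cast
  calc _ ≤ (Finset.univ.image (fun j : Fin k => L (A (List.ofFn x) j))).card := by
        apply Finset.card_le_card
        intro K hK
        obtain ⟨j, hj⟩ := (Finset.mem_filter.mp hK).2
        exact Finset.mem_image.mpr ⟨j, Finset.mem_univ _, hj⟩
    _ ≤ k := by simpa using Finset.card_image_le (s := (Finset.univ : Finset (Fin k)))

lemma identifiedCount_insert (L : ℕ → Set U) (A : ListIdentifier U k) {F : Finset (Set U)}
    {K : Set U} (hK : K ∉ F) {t : ℕ} (x : Fin t → U) :
    identifiedCount L A (insert K F) x = identifiedCount L A F x + identifiedCount L A {K} x := by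
  unfold identifiedCount
  rw [Finset.insert_eq, Finset.filter_union, Finset.card_union_of_disjoint, add_comm]
  · push_cast; rfl
  · exact Finset.disjoint_filter_filter (by simpa using hK)

lemma weightedSum_add (w : U → ℝ≥0∞) (t : ℕ) (G G' : (Fin t → U) → ℝ≥0∞) :
    weightedSum w t (fun x => G x + G' x) = weightedSum w t G + weightedSum w t G' := by
  unfold weightedSum
  rw [← ENNReal.tsum_add]
  simp only [mul_add]

lemma add_lt_weightedSum_insert (L : ℕ → Set U) (A : ListIdentifier U k) {F : Finset (Set U)}
    {K : Set U} (hK : K ∉ F) {w : U → ℝ≥0∞} {t : ℕ} {c q : ℝ≥0∞} (hc : c ≠ ∞)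
    (h1 : c ≤ weightedSum w t (identifiedCount L A F))
    (h2 : q < weightedSum w t (identifiedCount L A {K})) :
    c + q < weightedSum w t (identifiedCount L A (insert K F)) := by
  have : (identifiedCount L A (insert K F) : (Fin t → U) → ℝ≥0∞) =
      fun x => identifiedCount L A F x + identifiedCount L A {K} x :=
    funext fun x => identifiedCount_insert L A hK x
  rw [this, weightedSum_add]
  exact ENNReal.add_lt_add_of_le_of_lt hc h1 h2

/-- A strict lower bound on an integral against `D` is already witnessed by a partial weight. -/
lemma IsPartialWeight.exists_lt_weightedSum {K : Set U} {w : U → ℝ≥0∞}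
    (hw : IsPartialWeight K w) {D : PMF U} (hD : IsValid D K) (hwD : w ≤ D) {e : U} (he : e ∈ K)
    {t : ℕ} {G : (Fin t → U) → ℝ≥0∞} {c : ℝ≥0∞} (hc : c < weightedSum D t G) :
    ∃ w', IsPartialWeight K w' ∧ w ≤ w' ∧ 0 < w' e ∧ c < weightedSum w' t G := by
  unfold weightedSum at hc
  rw [ENNReal.tsum_eq_iSup_sum] at hc
  obtain ⟨s, hs⟩ := lt_iSup_iff.mp hc
  set S := ∑ x ∈ s, (∏ i, D (x i)) * G x with hS
  -- Scaling `D` by `r` costs a factor `r ^ t` on samples of length `t`, which the strict inequality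
  -- can absorb for `r` near `1`.
  obtain ⟨r, hrS, hr0, hr1⟩ : ∃ r : ℝ≥0∞, c < r ^ t * S ∧ 0 < r ∧ r < 1 := by
    have hc1 : c < 1 ^ t * S := by simpa using hs
    have hlim : Tendsto (fun r : ℝ≥0∞ => r ^ t * S) (𝓝[<] 1) (𝓝 (1 ^ t * S)) := by
      refine ENNReal.Tendsto.mul_const ?_ (Or.inl (by simp))
      exact ((ENNReal.continuous_pow t).tendsto 1).mono_left nhdsWithin_le_nhds
    have : (𝓝[<] (1 : ℝ≥0∞)).NeBot := nhdsLT_neBot_of_exists_lt ⟨0, zero_lt_one⟩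
    have h1 := hlim.eventually_const_lt hc1
    have h2 : ∀ᶠ r : ℝ≥0∞ in 𝓝[<] 1, 0 < r ∧ r < 1 := Ioo_mem_nhdsLT zero_lt_one
    obtain ⟨r, h3, h4⟩ := (h1.and h2).exists
    exact ⟨r, h3, h4⟩
  set T : Set U := insert e (Function.support w ∪ ⋃ x ∈ s, Set.range x) with hT
  have hTfin : T.Finite := by
    refine Set.Finite.insert _ (hw.finite.union ?_)
    exact s.finite_toSet.biUnion fun x _ => Set.finite_range x
  have hD0 : ∀ x, D x ≠ 0 → x ∈ K := fun x hx => (hD x).mp (pos_iff_ne_zero.mpr hx)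
  have hrr : r + (1 - r) = 1 := add_tsub_cancel_of_le hr1.le
  have hrD : ∀ x ∈ T, r * D x ≤ r * T.indicator D x + (1 - r) * w x := by
    intro x hx
    simp [hx]
  -- The mixture dominates `w` because `w ≤ D`, and its mass stays below one because that of `w`
  -- does.
  refine ⟨fun x => r * T.indicator D x + (1 - r) * w x, ⟨?_, ?_, ?_⟩, ?_, ?_, ?_⟩
  · refine hTfin.subset fun x hx => ?_
    by_contra hxT
    apply hx
    have : w x = 0 := by
      by_contra h
      exact hxT (Or.inr (Or.inl h))
    simp [hxT, this]
  · intro x hx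
    by_contra hxK
    apply hx
    have h1 : D x = 0 := by
      by_contra h
      exact hxK (hD0 x h)
    have h2 : w x = 0 := le_zero_iff.mp ((hwD x).trans h1.le)
    simp [h2, Set.indicator_apply, h1]
  · rw [ENNReal.tsum_add, ENNReal.tsum_mul_left, ENNReal.tsum_mul_left]
    have h1 : ∑' x, T.indicator D x ≤ 1 := by
      rw [← D.tsum_coe]
      exact ENNReal.tsum_le_tsum fun x => Set.indicator_le_self T D x
    calc _ ≤ r * 1 + (1 - r) * ∑' x, w x := by gcongr
      _ < r * 1 + (1 - r) * 1 := by
        refine ENNReal.add_lt_add_left (by simpa using (hr1.trans ENNReal.one_lt_top).ne) ?_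
        exact ENNReal.mul_lt_mul_right (tsub_pos_of_lt hr1).ne'
          (ne_top_of_le_ne_top ENNReal.one_ne_top tsub_le_self) hw.lt_one
      _ = 1 := by rw [mul_one, mul_one, hrr]
  · intro x
    by_cases hx : x ∈ T
    · calc w x = r * w x + (1 - r) * w x := by rw [← add_mul, hrr, one_mul]
        _ ≤ _ := by
          simp only [hx, Set.indicator_of_mem]
          gcongr
          exact hwD x
    · have : w x = 0 := by
        by_contra h
        exact hx (Or.inr (Or.inl h))
      simp [this]
  · exact (ENNReal.mul_pos hr0.ne' ((hD e).mpr he).ne').trans_le (hrD e (Or.inl rfl))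
  · refine hrS.trans_le ?_
    unfold weightedSum
    refine le_trans ?_ (ENNReal.sum_le_tsum s)
    rw [hS, Finset.mul_sum]
    refine Finset.sum_le_sum fun x hx => ?_
    rw [← mul_assoc]
    gcongr
    calc r ^ t * ∏ i, D (x i) = ∏ i, r * D (x i) := by simp [Finset.prod_mul_distrib]
      _ ≤ _ := Finset.prod_le_prod' fun i _ => hrD _ (Or.inr (Or.inr ?_))
    exact Set.mem_biUnion hx ⟨i, rfl⟩

/-! ### Valid distributions above partial weights, and the diagonal construction -/

section Countable

variable [Countable U]

lemma exists_isValid {K : Set U} (hK : K.Nonempty) : ∃ D : PMF U, IsValid D K := by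
  obtain ⟨f, hf, hs⟩ := ENNReal.exists_pos_sum_of_countable' one_ne_zero U
  have h1 : ∑' x, K.indicator f x ≠ ∞ :=
    ((ENNReal.tsum_le_tsum fun x => Set.indicator_le_self K f x).trans_lt
      (hs.trans ENNReal.one_lt_top)).ne
  have h0 : ∑' x, K.indicator f x ≠ 0 := by
    obtain ⟨a, ha⟩ := hK
    intro h
    have := ENNReal.tsum_eq_zero.mp h a
    simp [ha] at this
    exact (hf a).ne' this
  refine ⟨PMF.normalize _ h0 h1, fun x => ?_⟩
  rw [pos_iff_ne_zero, ← PMF.mem_support_iff, PMF.mem_support_normalize_iff]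
  by_cases hx : x ∈ K
  · simp [hx, (hf x).ne']
  · simp [hx]

/-- The missing mass is spread over `K` by a valid distribution; if nothing is missing, the weight
must already charge all of `K`. -/
lemma exists_isValid_ge {K : Set U} (hK : K.Nonempty) {w : U → ℝ≥0∞}
    (hsub : Function.support w ⊆ K) (hle : ∑' x, w x ≤ 1)
    (h : ∑' x, w x < 1 ∨ K ⊆ Function.support w) : ∃ D : PMF U, IsValid D K ∧ w ≤ D := by
  obtain ⟨d, hd⟩ := exists_isValid hK
  have hsum : ∑' x, (w x + (1 - ∑' x, w x) * d x) = 1 := by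
    rw [ENNReal.tsum_add, ENNReal.tsum_mul_left, d.tsum_coe, mul_one, add_tsub_cancel_of_le hle]
  refine ⟨⟨fun x => w x + (1 - ∑' x, w x) * d x, ENNReal.summable.hasSum_iff.mpr hsum⟩,
    fun x => ?_, fun x => le_self_add⟩
  change 0 < w x + (1 - ∑' x, w x) * d x ↔ x ∈ K
  have hdx := hd x
  constructor
  · intro hx
    by_contra hxK
    have h1 : w x = 0 := by
      by_contra h1
      exact hxK (hsub h1)
    have h2 : d x = 0 := by simpa [hxK] using hdx
    simp [h1, h2] at hx
  · intro hx
    rcases h with h | h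
    · exact (ENNReal.mul_pos (tsub_pos_of_lt h).ne' (hdx.mpr hx).ne').trans_le
        le_add_self
    · exact (pos_iff_ne_zero.mpr (h hx)).trans_le le_self_add

lemma IsPartialWeight.exists_isValid_ge {K : Set U} (hK : K.Nonempty) {w : U → ℝ≥0∞}
    (hw : IsPartialWeight K w) : ∃ D : PMF U, IsValid D K ∧ w ≤ D :=
  ListIdentification.exists_isValid_ge hK hw.subset hw.lt_one.le (Or.inl hw.lt_one)

lemma exists_isValid_ge_of_monotone {K : Set U} (hK : K.Nonempty) {w : ℕ → U → ℝ≥0∞}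
    (hw : ∀ i, IsPartialWeight K (w i)) (hmono : Monotone w)
    (hpos : ∀ x ∈ K, ∃ i, 0 < w i x) : ∃ D : PMF U, IsValid D K ∧ ∀ i, w i ≤ D := by
  have hsup : ∀ i, w i ≤ fun x => ⨆ i, w i x := fun i x => le_iSup (fun i => w i x) i
  obtain ⟨D, hD, hle⟩ := ListIdentification.exists_isValid_ge (w := fun x => ⨆ i, w i x) hK
    (fun x hx => by
      by_contra hxK
      apply hx
      simp only [ENNReal.iSup_eq_zero]
      intro i
      by_contra h
      exact hxK ((hw i).subset h))
    (by
      rw [ENNReal.tsum_eq_iSup_sum]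
      refine iSup_le fun s => ?_
      rw [ENNReal.finsetSum_iSup_of_monotone fun x i j hij => hmono hij x]
      exact iSup_le fun i => (ENNReal.sum_le_tsum s).trans (hw i).lt_one.le)
    (Or.inr fun x hx => by
      obtain ⟨i, hi⟩ := hpos x hx
      exact (hi.trans_le (hsup i x)).ne')
  exact ⟨D, hD, fun i => (hsup i).trans hle⟩

/-- If `A` identifies every language with probability eventually greater than `q`, then near every
partial weight on a language that is bad of order `j` the identifier names `j + 1` different
languages at the same time, each with probability greater than `q` on average. -/
lemma exists_lt_weightedSum_of_isBad {L : ℕ → Set U} (hL : ∀ i, (L i).Nonempty)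
    (A : ListIdentifier U k) {q : ℝ≥0∞} (hq : q ≠ ∞)
    (H : ∀ z, ∀ D : PMF U, IsValid D (L z) →
      ∀ᶠ t : ℕ in atTop, q < weightedSum D t (identifiedCount L A {L z})) (j : ℕ) :
    ∀ z, IsBad L j (L z) → ∀ w, IsPartialWeight (L z) w → ∀ n : ℕ,
      ∃ t ≥ n, ∃ F : Finset (Set U), F.card = j + 1 ∧ (∀ K ∈ F, K ⊆ L z) ∧
        ∃ w', IsPartialWeight (L z) w' ∧ w ≤ w' ∧
          ((j + 1 : ℕ) : ℝ≥0∞) * q < weightedSum w' t (identifiedCount L A F) := by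
  induction j with
  | zero =>
    intro z _ w hw n
    obtain ⟨D, hD, hwD⟩ := hw.exists_isValid_ge (hL z)
    obtain ⟨t, ht, hn⟩ := ((H z D hD).and (eventually_ge_atTop n)).exists
    obtain ⟨e, he⟩ := hL z
    obtain ⟨w', h1, h2, -, h3⟩ := hw.exists_lt_weightedSum hD hwD he ht
    exact ⟨t, hn, {L z}, by simp, by simp, w', h1, h2, by simpa using h3⟩
  | succ j ih =>
    intro z hbad w hw n
    obtain ⟨e, he⟩ := (L z).to_countable.exists_eq_range (hL z)
    have heL : ∀ i, e i ∈ L z := fun i => he ▸ ⟨i, rfl⟩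
    have step : ∀ (v : {v // IsPartialWeight (L z) v}) (i : ℕ),
        ∃ v' : {v // IsPartialWeight (L z) v}, v.1 ≤ v'.1 ∧ 0 < v'.1 (e i) ∧
          ∃ t ≥ i, ∃ F : Finset (Set U), F.card = j + 1 ∧ (∀ K ∈ F, K ⊆ L z) ∧ L z ∉ F ∧
            ((j + 1 : ℕ) : ℝ≥0∞) * q < weightedSum v'.1 t (identifiedCount L A F) := by
      rintro ⟨v, hv⟩ i
      obtain ⟨D, hD, hvD⟩ := hv.exists_isValid_ge (hL z)
      -- The integral is a dummy (`t = 0`, `G = 1`); the call only gives `e i` positive weight, so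
      -- that the limit charges all of `L z`.
      obtain ⟨v₁, hv₁, hle₁, hpos, -⟩ := hv.exists_lt_weightedSum hD hvD (heL i) (t := 0)
        (G := fun _ => 1) (c := 0) (by simp [weightedSum])
      -- Badness applied to the support of `v₁`: the same weight lives on a strictly smaller bad
      -- language, where the induction hypothesis applies.
      obtain ⟨a, ha, hsub, hbad'⟩ := hbad hv₁.finite.toFinset (by simpa using hv₁.subset)
      obtain ⟨t, ht, F, hcard, hF, v₂, hv₂, hle₂, hlt⟩ := ih a hbad' v₁
        ⟨hv₁.finite, by simpa using ha, hv₁.lt_one⟩ i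
      exact ⟨⟨v₂, hv₂.finite, hv₂.subset.trans hsub.subset, hv₂.lt_one⟩, hle₁.trans hle₂,
        hpos.trans_le (hle₂ _), t, ht, F, hcard, fun K hK => (hF K hK).trans hsub.subset,
        fun h => hsub.not_subset (hF _ h), hlt⟩
    choose next hnext hpos time htime F hcard hF hnot hlt using step
    let v : ℕ → {v // IsPartialWeight (L z) v} := fun i => Nat.rec ⟨w, hw⟩ (fun i u => next u i) i
    have hv : Monotone fun i => (v i).1 := monotone_nat_of_le_succ fun i => hnext (v i) i
    obtain ⟨D, hD, hvD⟩ := exists_isValid_ge_of_monotone (hL z) (fun i => (v i).2) hv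
      (fun x hx => by
        obtain ⟨i, rfl⟩ := he ▸ hx
        exact ⟨i + 1, hpos (v i) i⟩)
    -- The limit `D` is valid for `L z`, so at late stages `L z` is named too, in addition to the `j
    -- + 1` smaller languages of that stage.
    obtain ⟨m, hm⟩ := eventually_atTop.mp (H z D hD)
    set i := max m n
    have hti := htime (v i) i
    have hq1 : ((j + 1 : ℕ) : ℝ≥0∞) * q ≠ ∞ := ENNReal.mul_ne_top (by simp) hq
    have hsum := add_lt_weightedSum_insert L A (hnot (v i) i) hq1
      ((hlt (v i) i).le.trans (weightedSum_mono (hvD (i + 1)) _ _))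
      (hm (time (v i) i) ((le_max_left m n).trans hti))
    obtain ⟨w', hw', hle, -, hlt'⟩ := hw.exists_lt_weightedSum hD (hvD 0) (heL 0) hsum
    refine ⟨time (v i) i, (le_max_right m n).trans hti, insert (L z) (F (v i) i), ?_, ?_, w', hw',
      hle, ?_⟩
    · rw [Finset.card_insert_of_notMem (hnot (v i) i), hcard]
    · intro K hK
      rcases Finset.mem_insert.mp hK with rfl | hK
      · exact subset_rfl
      · exact hF (v i) i K hK
    · refine lt_of_eq_of_lt ?_ hlt'
      push_cast
      ring

end Countable

/-! ### From failure probabilities to bad languages -/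

section Measure

variable [Countable U] [MeasurableSpace U] [DiscreteMeasurableSpace U]

lemma measurableSet_finFun {t : ℕ} (E : Set (Fin t → U)) : MeasurableSet E :=
  E.to_countable.measurableSet

lemma pi_apply_eq_weightedSum (D : PMF U) (t : ℕ) (E : Set (Fin t → U)) :
    Measure.pi (fun _ : Fin t => D.toMeasure) E = weightedSum D t (E.indicator 1) := by
  rw [← Measure.tsum_indicator_apply_singleton _ E (measurableSet_finFun E)]
  refine tsum_congr fun x => ?_
  by_cases hx : x ∈ E
  · simp [hx, Measure.pi_singleton, PMF.toMeasure_apply_singleton]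
  · simp [hx]

lemma weightedSum_pmf_le (D : PMF U) (t : ℕ) {G : (Fin t → U) → ℝ≥0∞} {c : ℝ≥0∞}
    (hG : ∀ x, G x ≤ c) : weightedSum D t G ≤ c := by
  calc weightedSum D t G ≤ ∑' x : Fin t → U, (∏ i, D (x i)) * Set.univ.indicator 1 x * c := by
        refine ENNReal.tsum_le_tsum fun x => ?_
        simpa using mul_le_mul_right (hG x) _
    _ = c := by
        rw [ENNReal.tsum_mul_right]
        have := pi_apply_eq_weightedSum D t Set.univ
        rw [measure_univ] at this
        unfold weightedSum at this
        rw [← this, one_mul]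

lemma lt_weightedSum_of_failProb_lt (L : ℕ → Set U) (A : ListIdentifier U k) (K : Set U)
    (D : PMF U) (t : ℕ) (h : failProb L A K D t < 1 / ((k : ℝ) + 1)) :
    ENNReal.ofReal (k / ((k : ℝ) + 1)) < weightedSum D t (identifiedCount L A {K}) := by
  have hind : (identifiedCount L A {K} : (Fin t → U) → ℝ≥0∞)
      = {x : Fin t → U | ¬ Identifies L (A (List.ofFn x)) K}ᶜ.indicator 1 := by
    ext x
    by_cases hx : Identifies L (A (List.ofFn x)) K <;>
      simp [identifiedCount, Finset.filter_singleton, hx]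
  rw [hind, ← pi_apply_eq_weightedSum]
  rw [ENNReal.ofReal_lt_iff_lt_toReal (by positivity) (measure_ne_top _ _)]
  change _ < Measure.real _ _
  rw [probReal_compl_eq_one_sub (measurableSet_finFun _)]
  change _ < 1 - failProb L A K D t
  have : (k : ℝ) / (k + 1) = 1 - 1 / (k + 1) := by field_simp; ring
  linarith

theorem not_isBad_of_eventually_failProb_lt {L : ℕ → Set U} (hL : ∀ i, (L i).Nonempty)
    (A : ListIdentifier U k)
    (H : ∀ z, ∀ D : PMF U, IsValid D (L z) →
      ∀ᶠ t : ℕ in atTop, failProb L A (L z) D t < 1 / ((k : ℝ) + 1)) (z : ℕ) :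
    ¬ IsBad L k (L z) := by
  intro hbad
  obtain ⟨t, -, F, -, -, w, hw, -, hlt⟩ := exists_lt_weightedSum_of_isBad hL A
    (q := ENNReal.ofReal (k / ((k : ℝ) + 1))) ENNReal.ofReal_ne_top
    (fun z D hD => (H z D hD).mono fun t ht => lt_weightedSum_of_failProb_lt L A (L z) D t ht)
    k z hbad 0 ⟨by simp [Function.support], by simp [Function.support], by simp⟩ 0
  obtain ⟨D, -, hwD⟩ := hw.exists_isValid_ge (hL z)
  have hle := (weightedSum_mono hwD t (identifiedCount L A F)).trans
    (weightedSum_pmf_le D t fun x => identifiedCount_le L A F x)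
  refine absurd (hlt.trans_le hle) (not_lt.mpr (le_of_eq ?_))
  rw [← ENNReal.ofReal_natCast (k + 1), ← ENNReal.ofReal_mul (by positivity),
    ← ENNReal.ofReal_natCast k]
  congr 1
  push_cast
  field_simp

end Measure

/-! ### The telltale identifier -/

/-- If no language is bad of order `k`, some identifier is correct as soon as the sample contains
a fixed finite subset of the target language. -/
theorem exists_identifier_of_not_isBad {L : ℕ → Set U} (hL : ∀ i, (L i).Nonempty)
    (h : ∀ z, ¬ IsBad L k (L z)) :
    ∃ A : ListIdentifier U k, ∀ z, ∃ F : Finset U, (F : Set U) ⊆ L z ∧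
      ∀ x : List U, (∀ a ∈ x, a ∈ L z) → (∀ a ∈ F, a ∈ x) → Identifies L (A x) (L z) := by
  have hrank : ∀ z, ∃ j : Fin k, ∃ T : Finset U, IsBad L j (L z) ∧ (T : Set U) ⊆ L z ∧
      ∀ i, (T : Set U) ⊆ L i → L i ⊂ L z → ¬ IsBad L j (L i) := by
    intro z
    have hex : ∃ j, ¬ IsBad L j (L z) := ⟨k, h z⟩
    obtain ⟨j, hj⟩ : ∃ j, Nat.find hex = j + 1 := by
      refine Nat.exists_eq_succ_of_ne_zero fun h0 => ?_
      have := Nat.find_spec hex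
      rw [h0] at this
      exact this trivial
    have hbad : IsBad L j (L z) := not_not.mp (Nat.find_min hex (by omega))
    have hnot : ¬ IsBad L (j + 1) (L z) := hj ▸ Nat.find_spec hex
    have hjk : j < k := by
      have := Nat.find_le (h := hex) (n := k) (h z)
      omega
    simp only [IsBad, not_forall, not_exists, not_and] at hnot
    obtain ⟨T, hT, hT'⟩ := hnot
    exact ⟨⟨j, hjk⟩, T, hbad, hT, hT'⟩
  choose r T hbad hTL hT using hrank
  let cand : List U → Fin k → ℕ → Prop := fun x j i =>
    r i = j ∧ (∀ a ∈ T i, a ∈ x) ∧ ∀ a ∈ x, a ∈ L i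
  refine ⟨fun x j => if hx : ∃ i, cand x j i then Nat.find hx else 0, fun z => ?_⟩
  -- The strings `y i` with `i < z` refute every earlier candidate that does not contain `L z`.
  have hy : ∀ i, ∃ y ∈ L z, ¬ L z ⊆ L i → y ∉ L i := by
    intro i
    by_cases hi : L z ⊆ L i
    · obtain ⟨y, hy⟩ := hL z
      exact ⟨y, hy, fun h => absurd hi h⟩
    · obtain ⟨y, hy, hy'⟩ := Set.not_subset.mp hi
      exact ⟨y, hy, fun _ => hy'⟩
  choose y hyL hy using hy
  refine ⟨T z ∪ (Finset.range z).image y, ?_, fun x hx hF => ⟨r z, ?_⟩⟩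
  · intro a ha
    rcases Finset.mem_union.mp ha with ha | ha
    · exact hTL z ha
    · obtain ⟨i, -, rfl⟩ := Finset.mem_image.mp ha
      exact hyL i
  · have hz : cand x (r z) z := ⟨rfl, fun a ha => hF a (Finset.mem_union_left _ ha), hx⟩
    have hex : ∃ i, cand x (r z) i := ⟨z, hz⟩
    beta_reduce
    rw [dif_pos hex]
    obtain ⟨hr, hTx, hxi⟩ := Nat.find_spec hex
    rcases (Nat.find_le (h := hex) hz).eq_or_lt with heq | hlt
    · rw [heq]
    · set i := Nat.find hex
      by_contra hne
      have hsub : L z ⊆ L i := by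
        by_contra hns
        exact hy i hns (hxi _ (hF _ (Finset.mem_union_right _
          (Finset.mem_image_of_mem y (Finset.mem_range.mpr hlt)))))
      -- Now `L z` is strictly smaller than `L i`, contains its telltale and is bad of the same
      -- order, against the choice of `T i`.
      exact hT i z (fun a ha => hx a (hTx a ha)) (hsub.ssubset_of_ne (Ne.symm hne))
        (hr ▸ hbad z)

theorem identifiableInLimit_of_not_isBad {L : ℕ → Set U} (hL : ∀ i, (L i).Nonempty)
    (h : ∀ z, ¬ IsBad L k (L z)) : IdentifiableInLimit k L := by
  obtain ⟨A, hA⟩ := exists_identifier_of_not_isBad hL h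
  refine ⟨A, fun z x hx => ?_⟩
  obtain ⟨F, hFL, hF⟩ := hA z
  choose! n hn using hx.2
  refine ⟨F.sup n + 1, fun t ht => hF _ ?_ fun a ha => ?_⟩
  · intro a ha
    obtain ⟨i, rfl⟩ := List.mem_ofFn.mp ha
    exact hx.1 i
  · have : n a ≤ F.sup n := Finset.le_sup ha
    exact List.mem_ofFn.mpr ⟨⟨n a, by omega⟩, hn a (hFL ha)⟩

/-! ### Random samples: infinite products and failure bounds -/

variable [MeasurableSpace U]

lemma infinitePi_map_initial (μ : Measure U) [IsProbabilityMeasure μ] (t : ℕ) :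
    (Measure.infinitePi fun _ : ℕ => μ).map (fun x (i : Fin t) => x i)
      = Measure.pi fun _ : Fin t => μ := by
  refine (Measure.pi_eq fun s hs => ?_).symm
  rw [Measure.map_apply (by fun_prop) (.univ_pi hs)]
  have : (fun (x : ℕ → U) (i : Fin t) => x i) ⁻¹' Set.univ.pi s =
      Set.pi (Finset.range t) (fun i => if h : i < t then s ⟨i, h⟩ else Set.univ) := by
    ext x
    simp only [Set.mem_preimage, Set.mem_pi, Set.mem_univ, true_imp_iff, Finset.coe_range,
      Set.mem_Iio]
    exact ⟨fun h i hi => by simpa [hi] using h ⟨i, hi⟩, fun h i => by simpa using h i i.2⟩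
  rw [this, Measure.infinitePi_pi, Finset.prod_range]
  · simp
  · intro i hi
    rw [dif_pos (Finset.mem_range.mp hi)]
    exact hs _

lemma failProb_le_one (L : ℕ → Set U) (A : ListIdentifier U k) (K : Set U) (D : PMF U) (t : ℕ) :
    failProb L A K D t ≤ 1 := measureReal_le_one

lemma Rate.tendsto_mul_comp (R : Rate) (c₁ : ℝ) {c₂ : ℝ} (hc₂ : 0 < c₂) :
    Tendsto (fun t : ℕ => c₁ * R.toFun (c₂ * (t : ℝ))) atTop (𝓝 0) := by
  simpa using (R.tendsto_zero.comp
    (tendsto_natCast_atTop_atTop.const_mul_atTop hc₂)).const_mul c₁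

theorem not_canBeIdentifiedAtRate_of_noRate {L : ℕ → Set U} (h : NoRate k L) (R : Rate) :
    ¬ CanBeIdentifiedAtRate k L R := by
  rintro ⟨A, hA⟩
  obtain ⟨z, D, hD, hpos⟩ := h A
  obtain ⟨c₁, c₂, -, hc₂, hle⟩ := hA z D hD
  have : Tendsto (fun t : ℕ => failProb L A (L z) D t) atTop (𝓝 0) :=
    tendsto_of_tendsto_of_tendsto_of_le_of_le' tendsto_const_nhds (R.tendsto_mul_comp c₁ hc₂)
      (Eventually.of_forall fun t => measureReal_nonneg)
      ((eventually_ge_atTop 1).mono fun t ht => hle t ht)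
  rw [this.limsup_eq] at hpos
  exact lt_irrefl _ hpos

variable [DiscreteMeasurableSpace U]

lemma IsValid.toMeasure_compl_eq_zero {D : PMF U} {K : Set U} (hD : IsValid D K) :
    D.toMeasure Kᶜ = 0 := by
  rw [PMF.toMeasure_apply_eq_zero_iff _ (.of_discrete)]
  refine Set.disjoint_left.mpr fun x hx hxK => hxK ?_
  exact (hD x).mp (pos_iff_ne_zero.mpr hx)

lemma toMeasure_compl_singleton (D : PMF U) (y : U) : D.toMeasure {y}ᶜ = 1 - D y := by
  rw [prob_compl_eq_one_sub (.of_discrete), PMF.toMeasure_apply_singleton _ _ .of_discrete]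

/-- Up to a null set, failure means that some string of `F` is never drawn; a union bound finishes.
-/
lemma failProb_le_sum {L : ℕ → Set U} {A : ListIdentifier U k} {K : Set U} {F : Finset U}
    (hF : ∀ x : List U, (∀ a ∈ x, a ∈ K) → (∀ a ∈ F, a ∈ x) → Identifies L (A x) K)
    {D : PMF U} (hD : IsValid D K) (t : ℕ) :
    failProb L A K D t ≤ ∑ y ∈ F, (1 - (D y).toReal) ^ t := by
  set μ := Measure.pi fun _ : Fin t => D.toMeasure with hμ
  have hnull : μ.real {x | ∃ i, x i ∉ K} = 0 := by
    rw [measureReal_eq_zero_iff, Set.ofPred_exists]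
    refine measure_iUnion_null fun i => ?_
    exact Measure.pi_eval_preimage_null (fun _ : Fin t => D.toMeasure) hD.toMeasure_compl_eq_zero
  have hmiss : ∀ y, μ.real {x | ∀ i, x i ≠ y} = (1 - (D y).toReal) ^ t := by
    intro y
    have : {x : Fin t → U | ∀ i, x i ≠ y} = Set.univ.pi fun _ => {y}ᶜ := by ext; simp
    rw [this, hμ, measureReal_def, Measure.pi_pi]
    simp [toMeasure_compl_singleton, ENNReal.toReal_sub_of_le (D.coe_le_one y)]
  calc failProb L A K D t ≤ μ.real ({x | ∃ i, x i ∉ K} ∪ ⋃ y ∈ F, {x | ∀ i, x i ≠ y}) := by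
        refine measureReal_mono fun x hx => ?_
        by_contra hcon
        simp only [Set.mem_union, Set.mem_ofPred_eq, Set.mem_iUnion, not_or, not_exists,
          not_not, not_forall, exists_prop, not_and] at hcon
        refine hx (hF _ (fun a ha => ?_) fun a ha => ?_)
        · obtain ⟨i, rfl⟩ := List.mem_ofFn.mp ha
          exact hcon.1 i
        · obtain ⟨i, hi⟩ := hcon.2 a ha
          exact List.mem_ofFn.mpr ⟨i, hi⟩
    _ ≤ 0 + ∑ y ∈ F, μ.real {x | ∀ i, x i ≠ y} :=
        (measureReal_union_le _ _).trans (add_le_add hnull.le (measureReal_biUnion_finset_le _ _))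
    _ = _ := by simp [hmiss]

variable [Countable U]

lemma ae_isEnumeration {D : PMF U} {K : Set U} (hD : IsValid D K) :
    ∀ᵐ x ∂(Measure.infinitePi fun _ : ℕ => D.toMeasure), IsEnumeration K x := by
  refine Filter.Eventually.and (ae_all_iff.mpr fun i => ?_) ?_
  · have hK : ∀ᵐ a ∂D.toMeasure, a ∈ K := hD.toMeasure_compl_eq_zero
    exact (measurePreserving_eval_infinitePi (fun _ : ℕ => D.toMeasure) i).quasiMeasurePreserving.ae
      hK
  · refine (ae_ball_iff K.to_countable).mpr fun y hy => ?_
    rw [ae_iff]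
    have hlt : 1 - D y < 1 :=
      ENNReal.sub_lt_self ENNReal.one_ne_top one_ne_zero ((hD y).mpr hy).ne'
    refine le_antisymm (ge_of_tendsto' (ENNReal.tendsto_pow_atTop_nhds_zero_of_lt_one hlt)
      fun n => ?_) zero_le
    calc _ ≤ Measure.infinitePi (fun _ : ℕ => D.toMeasure)
          (Set.pi (Finset.range n) fun _ => {y}ᶜ) :=
          measure_mono fun x hx i _ hi => by
            have hx : ¬ ∃ i, x i = y := hx
            exact hx ⟨i, hi⟩
      _ = (1 - D y) ^ n := by
        rw [Measure.infinitePi_pi _ fun _ _ => .of_discrete]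
        simp [toMeasure_compl_singleton]

lemma failProb_eq_infinitePi (L : ℕ → Set U) (A : ListIdentifier U k) (K : Set U) (D : PMF U)
    (t : ℕ) : failProb L A K D t = (Measure.infinitePi fun _ : ℕ => D.toMeasure).real
      {x | ¬ Identifies L (A (List.ofFn fun i : Fin t => x i)) K} := by
  rw [failProb, ← infinitePi_map_initial, map_measureReal_apply (by fun_prop)
    (measurableSet_finFun _)]
  rfl

/-- An infinite random sample is almost surely an enumeration, so the failure events have indicators
tending to zero almost everywhere. -/
theorem tendsto_failProb_of_identifiesInLimit {L : ℕ → Set U} {A : ListIdentifier U k}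
    (hA : IdentifiesInLimit L A) {z : ℕ} {D : PMF U} (hD : IsValid D (L z)) :
    Tendsto (failProb L A (L z) D) atTop (𝓝 0) := by
  have h := tendsto_measure_of_ae_tendsto_indicator_of_isFiniteMeasure atTop
    (μ := Measure.infinitePi fun _ : ℕ => D.toMeasure) (A := ∅)
    (As := fun t => {x | ¬ Identifies L (A (List.ofFn fun i : Fin t => x i)) (L z)})
    MeasurableSet.empty (fun t => by
      have hm : Measurable fun (x : ℕ → U) (i : Fin t) => x i := by fun_prop
      exact hm (measurableSet_finFun {x : Fin t → U | ¬ Identifies L (A (List.ofFn x)) (L z)}))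
    (by
      filter_upwards [ae_isEnumeration hD] with x hx
      obtain ⟨t₀, ht₀⟩ := hA z x hx
      filter_upwards [eventually_ge_atTop t₀] with t ht
      simp [ht₀ t ht])
  rw [measure_empty] at h
  have h' := (ENNReal.tendsto_toReal ENNReal.zero_ne_top).comp h
  refine h'.congr fun t => ?_
  rw [failProb_eq_infinitePi]
  rfl

theorem not_isBad_of_identifiableInLimit {L : ℕ → Set U} (hL : ∀ i, (L i).Nonempty)
    (h : IdentifiableInLimit k L) (z : ℕ) : ¬ IsBad L k (L z) := by
  obtain ⟨A, hA⟩ := h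
  exact not_isBad_of_eventually_failProb_lt hL A (fun z D hD =>
    (tendsto_failProb_of_identifiesInLimit hA hD).eventually_lt_const (by positivity)) z

/-! ### The three claims on rates -/

theorem canBeIdentifiedAtRate_exp {L : ℕ → Set U} (hL : ∀ i, (L i).Nonempty)
    (h : IdentifiableInLimit k L) : CanBeIdentifiedAtRate k L expRate := by
  obtain ⟨A, hA⟩ := exists_identifier_of_not_isBad hL (not_isBad_of_identifiableInLimit hL h)
  refine ⟨A, fun z D hD => ?_⟩
  obtain ⟨F, hFL, hF⟩ := hA z
  obtain ⟨c, hc, hcF⟩ : ∃ c : ℝ, 0 < c ∧ ∀ y ∈ F, c ≤ (D y).toReal := by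
    have hpos : ∀ y ∈ F, 0 < (D y).toReal := fun y hy =>
      ENNReal.toReal_pos ((hD y).mpr (hFL hy)).ne' (D.apply_ne_top y)
    rcases F.eq_empty_or_nonempty with rfl | hne
    · exact ⟨1, one_pos, by simp⟩
    · obtain ⟨y, hy, hmin⟩ := F.exists_min_image (fun y => (D y).toReal) hne
      exact ⟨_, hpos y hy, hmin⟩
  -- The `+ 1` keeps the constant positive when `F` is empty.
  refine ⟨F.card + 1, c, by positivity, hc, fun t _ => (failProb_le_sum hF hD t).trans ?_⟩
  change _ ≤ _ * Real.exp (-(c * t))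
  calc ∑ y ∈ F, (1 - (D y).toReal) ^ t ≤ ∑ _y ∈ F, Real.exp (-(c * t)) := by
        refine Finset.sum_le_sum fun y hy => ?_
        have h1 : (D y).toReal ≤ 1 := by
          simpa using ENNReal.toReal_mono ENNReal.one_ne_top (D.coe_le_one y)
        have h2 : 1 - (D y).toReal ≤ Real.exp (-c) := by
          have := Real.add_one_le_exp (-c)
          linarith [hcF y hy]
        calc (1 - (D y).toReal) ^ t ≤ Real.exp (-c) ^ t := by
              gcongr
          _ = _ := by rw [← Real.exp_nat_mul]; ring_nf
    _ ≤ _ := by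
        rw [Finset.sum_const, nsmul_eq_mul]
        gcongr
        linarith

/-- On the constant sequence some of `k + 1` different languages is missed infinitely often. -/
theorem exists_frequently_exp_le_failProb {L : ℕ → Set U} (h : IsNontrivialFor k L)
    (A : ListIdentifier U k) : ∃ z : ℕ, ∃ D : PMF U, IsValid D (L z) ∧
      ∃ᶠ t : ℕ in atTop, Real.exp (-2 * (t : ℝ)) ≤ failProb L A (L z) D t := by
  obtain ⟨i, hi, u, hu⟩ := h
  have hu : ∀ j, u ∈ L (i j) := Set.mem_iInter.mp hu
  have hmiss : ∀ t : ℕ, ∃ j, ¬ Identifies L (A (List.ofFn fun _ : Fin t => u)) (L (i j)) := by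
    intro t
    by_contra! hcon
    choose f hf using hcon
    have hinj : Function.Injective f := fun a b hab => hi (by
      change L (i a) = L (i b)
      rw [← hf a, ← hf b, hab])
    simpa using Fintype.card_le_of_injective f hinj
  obtain ⟨j, hj⟩ : ∃ j, ∃ᶠ t : ℕ in atTop,
      ¬ Identifies L (A (List.ofFn fun _ : Fin t => u)) (L (i j)) := by
    by_contra hcon
    simp only [not_exists, not_frequently, not_not] at hcon
    obtain ⟨t, ht⟩ := (eventually_all.mpr hcon).exists
    obtain ⟨j, hj⟩ := hmiss t
    exact hj (ht j)
  have hexp : ENNReal.ofReal (Real.exp (-2)) < 1 := by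
    rw [ENNReal.ofReal_lt_one]
    exact Real.exp_lt_one_iff.mpr (by norm_num)
  -- Mass at least `exp (-2)` on `u` makes the constant sample of length `t` have probability at
  -- least `exp (-2 * t)`.
  obtain ⟨D, hD, hle⟩ := IsPartialWeight.exists_isValid_ge
    (w := Pi.single u (ENNReal.ofReal (Real.exp (-2)))) ⟨u, hu j⟩
    ⟨(Set.finite_singleton u).subset Pi.support_single_subset,
      Pi.support_single_subset.trans (Set.singleton_subset_iff.mpr (hu j)), by
        rwa [tsum_pi_single]⟩
  refine ⟨i j, D, hD, hj.mono fun t ht => ?_⟩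
  have hDu : Real.exp (-2) ≤ (D u).toReal := by
    rw [← ENNReal.ofReal_le_iff_le_toReal (D.apply_ne_top u)]
    simpa using hle u
  calc Real.exp (-2 * (t : ℝ)) = Real.exp (-2) ^ t := by rw [← Real.exp_nat_mul]; ring_nf
    _ ≤ (D u).toReal ^ t := by gcongr
    _ = (Measure.pi fun _ : Fin t => D.toMeasure).real {fun _ => u} := by
        rw [measureReal_def, Measure.pi_singleton]
        simp [PMF.toMeasure_apply_singleton]
    _ ≤ failProb L A (L (i j)) D t :=
        measureReal_mono (Set.singleton_subset_iff.mpr ht)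

theorem cannotBeIdentifiedFaster_exp {L : ℕ → Set U} (h : IsNontrivialFor k L) :
    CannotBeIdentifiedFaster k L expRate := by
  intro A
  obtain ⟨z, D, hD, hf⟩ := exists_frequently_exp_le_failProb h A
  refine ⟨z, D, hD, 1, 2, one_pos, two_pos, hf.mono fun t ht => ?_⟩
  simpa [expRate] using ht

theorem exists_le_limsup_failProb {L : ℕ → Set U} (hL : ∀ i, (L i).Nonempty)
    (h : ¬ IdentifiableInLimit k L) (A : ListIdentifier U k) :
    ∃ z : ℕ, ∃ D : PMF U, IsValid D (L z) ∧
      1 / ((k : ℝ) + 1) ≤ limsup (fun t : ℕ => failProb L A (L z) D t) atTop := by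
  by_contra! hcon
  refine h (identifiableInLimit_of_not_isBad hL
    (not_isBad_of_eventually_failProb_lt hL A fun z D hD => ?_))
  exact eventually_lt_of_limsup_lt (hcon z D hD)
    (isBoundedUnder_of ⟨1, fun t => failProb_le_one L A (L z) D t⟩)

end ListIdentification

theorem theorem3 {U : Type*} [Countable U] [MeasurableSpace U] [DiscreteMeasurableSpace U]
    (k : ℕ) (hk : 1 ≤ k) (L : ℕ → Set U) (hL : ∀ i, (L i).Nonempty) :
    -- identifiable in the limit: exponential rate
    (IdentifiableInLimit k L → CanBeIdentifiedAtRate k L expRate) ∧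
    -- non-trivial: no rate faster than exponential
    (IsNontrivialFor k L →
      CannotBeIdentifiedFaster k L expRate ∧
      ∀ A : ListIdentifier U k, ∃ z : ℕ, ∃ D : PMF U, IsValid D (L z) ∧
        ∃ᶠ t : ℕ in atTop, Real.exp (-2 * (t : ℝ)) ≤ failProb L A (L z) D t) ∧
    -- identifiable in the limit and non-trivial: the exponential rate is optimal
    (IdentifiableInLimit k L → IsNontrivialFor k L → IsOptimalRate k L expRate) ∧
    -- not identifiable in the limit: no vanishing rate
    (¬ IdentifiableInLimit k L →
      (∀ A : ListIdentifier U k, ∃ z : ℕ, ∃ D : PMF U, IsValid D (L z) ∧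
        1 / ((k : ℝ) + 1) ≤ limsup (fun t : ℕ => failProb L A (L z) D t) atTop) ∧
      NoRate k L ∧
      ∀ R : Rate, ¬ CanBeIdentifiedAtRate k L R) := by
  have hlim := fun h : ¬ IdentifiableInLimit k L => exists_le_limsup_failProb hL h
  have hno : ¬ IdentifiableInLimit k L → NoRate k L := fun h A => by
    obtain ⟨z, D, hD, hle⟩ := hlim h A
    exact ⟨z, D, hD, lt_of_lt_of_le (by positivity) hle⟩
  exact ⟨canBeIdentifiedAtRate_exp hL,
    fun h => ⟨cannotBeIdentifiedFaster_exp h, exists_frequently_exp_le_failProb h⟩,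
    fun h h' => ⟨canBeIdentifiedAtRate_exp hL h, cannotBeIdentifiedFaster_exp h'⟩,
    fun h => ⟨hlim h, hno h, not_canBeIdentifiedAtRate_of_noRate (hno h)⟩⟩
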